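/- **Conventions.** For a set $A$, an ordinal word on $A$ of length $\alpha$ is a function $w:\alpha\to A$; it is a limit word if $\alpha$ is a (nonzero) limit ordinal. $w^\beta$ is $w$ concatenated $\beta$ times (length $|w|\cdot\beta$), a final segment of $w$ is a word $u$ with $w=vu$ for some word $v$, and the contraction $\operatorname{ctr}(w)$ is obtained from $w$ by replacing each maximal block of consecutive equal letters by a single letter. For a natural number $n$ an *$n$-symbol limit rule operator* is a (class) function $\Gamma$ from the ordinal words on ${}^\omega n$ (histories of tape contents) to ${}^\omega n$ (tape contents). For a word $H$ on ${}^\omega n$ and $c\in\omega$, $H|_c$ is the word on $n$ giving the history of the cell $c$. The operator $\Gamma$ is *simulational* if it is * stable: $\Gamma(x^\alpha)=x$ for all $x\in{}^\omega n$ and all limit ordinals $\alpha$; * cell-by-cell: there is $\gamma$, from ordinal words on $n$ to $n$, with $\Gamma(H)[c]=\gamma(H|_c)$ for all limit words $H$ and all cells $c$; * asymptotic: $\Gamma(H)=\Gamma(H')$ for every limit word $H$ and every non-empty final segment $H'$ of $H$; * contraction-proof: $\Gamma(H)=\Gamma(H')$ for all limit words $H,H'$ with $\operatorname{ctr}(H)=\operatorname{ctr}(H')$.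 It is *looping stable* if $\Gamma(H^\alpha)=\Gamma(H^{\alpha'})$ for every limit word $H$ and all limit ordinals $\alpha,\alpha'$. The $2$-symbol operator $\Gamma_{\sup}$ gives a cell the value $0$ if and only if its history is eventually $0$, and $1$ otherwise. A *$\Gamma$-machine* has the structure of a finite Turing machine with three tapes (input, working, output) over the symbols $0,\dots,n-1$ and one head; at successor stages it computes as a finite Turing machine, and at each limit stage the head is on the first cell, the state is a distinguished limit state, and the tape content is $\Gamma(H)$ for $H$ the history of the tape content so far (the three tapes being coded in one element of ${}^\omega n$). A machine that has halted keeps its halting snapshot at all later stages. A *snapshot* consists of the state, the head position and the tape content. For $2\le n$, an $n$-symbol operator $\Gamma$ *emulates* $\Gamma_{\sup}$ if for each $\Gamma_{\sup}$-machine $m$ (classical infinite time Turing machine) there is a $\Gamma$-machine $m'$, whose states include those of $m$, with the same start, limit and halting states, such that on every input $y\in{}^\omega 2$: 1. at every limit stage the snapshots of $m$ and $m'$ are the same; 2. for every stage $\mu$ that is $0$ or a limit, the snapshots of $m$ at the stages $\mu+j$ ($j<\omega$) appear in the same order among those of $m'$ at the stages $\mu+i$ ($i<\omega$), starting with equality at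 $\mu$ itself, consecutive ones being separated by finitely many other snapshots of $m'$; 3. each of these other snapshots of $m'$ has a symbol $s\notin\{0,1\}$ in at least one of its cells. For a permutation $\sigma$ of the $n$ symbols, $\Gamma^\sigma$ denotes $\Gamma$ with each symbol $s$ renamed to $\sigma(s)$: $\Gamma^\sigma(H)=\sigma(\Gamma(\sigma^{-1}(H)))$, with $\sigma,\sigma^{-1}$ applied to every cell. **Proposition.** Let $n\ge 2$ and let $\Gamma$ be an $n$-symbol simulational and looping stable operator. Then, up to a renaming of the symbols, $\Gamma$ emulates $\Gamma_{\sup}$: there is a permutation $\sigma$ of the $n$ symbols such that $\Gamma^\sigma$ emulates $\Gamma_{\sup}$. -/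

import Mathlib

universe u

namespace InfTM

/-! ### Ordinal words -/

/-- An ordinal word on the alphabet `A`: a function from an ordinal `len` to `A`. -/
@[ext]
structure OrdWord (A : Type) : Type (u + 1) where
  /-- the length of the word -/
  len : Ordinal.{u}
  /-- the letter at each position `i < len` -/
  get : ∀ i : Ordinal.{u}, i < len → A

namespace OrdWord

variable {A B : Type}

/-- A limit word: its length is a (nonzero) limit ordinal. -/
def IsLimit (w : OrdWord.{u} A) : Prop := Order.IsSuccLimit w.len

/-- Apply a map to every letter. -/
def map (f : A → B) (w : OrdWord.{u} A) : OrdWord.{u} B where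
  len := w.len
  get i hi := f (w.get i hi)

/-- The word `x ^ α`, for a single letter `x`. -/
def const (x : A) (α : Ordinal.{u}) : OrdWord.{u} A where
  len := α
  get _ _ := x

/-- The word `w ^ α`: `w` concatenated `α` times to itself, of length `|w| * α`. The letter at
position `|w| * δ + ρ`, where `ρ < |w|`, is `w[ρ]`. -/
noncomputable def rep (w : OrdWord.{u} A) (α : Ordinal.{u}) : OrdWord.{u} A where
  len := w.len * α
  get i hi := w.get (i % w.len) (Ordinal.mod_lt i (by
    rintro h
    rw [h, zero_mul] at hi
    exact absurd hi (not_lt.mpr (zero_le))))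

/-- `u` is a final segment (suffix) of `w`. -/
def IsFinalSegment (u w : OrdWord.{u} A) : Prop :=
  ∃ α : Ordinal.{u}, α + u.len = w.len ∧
    ∀ (i : Ordinal.{u}) (hi : i < u.len) (hi' : α + i < w.len), u.get i hi = w.get (α + i) hi'

/-- The position `i` starts a block of equal letters of `w`: for no `κ < i` is `w` constant on
`[κ, i]`. -/
def IsBlockStart (w : OrdWord.{u} A) (i : Ordinal.{u}) (hi : i < w.len) : Prop :=
  ∀ κ < i, ∃ (ξ : Ordinal.{u}) (hξ : ξ < i), κ ≤ ξ ∧ w.get ξ (hξ.trans hi) ≠ w.get i hi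

/-- The increasing enumeration `ν₀ < ν₁ < …` of the block starts of `w`, followed by all the
ordinals that are not positions of `w`. -/
noncomputable def blockSeq (w : OrdWord.{u} A) : Ordinal.{u} → Ordinal.{u} :=
  Ordinal.enumOrd {i | ∀ hi : i < w.len, w.IsBlockStart i hi}

/-- The contraction of `w`: every block of equal letters is replaced by a single letter. -/
noncomputable def ctr (w : OrdWord.{u} A) : OrdWord.{u} A where
  len := sInf {μ | w.len ≤ w.blockSeq μ}
  get μ hμ := w.get (w.blockSeq μ) (lt_of_not_ge fun h =>
    notMem_of_lt_csInf' hμ h)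

end OrdWord

/-! ### Limit rule operators -/

/-- An `n`-symbol limit rule operator, from histories of tape contents to tape contents. -/
abbrev LimitOperator (n : ℕ) : Type (u + 1) := OrdWord.{u} (ℕ → Fin n) → (ℕ → Fin n)

namespace LimitOperator

variable {n : ℕ}

/-- `Γ (x ^ α) = x` for every tape content `x` and every limit ordinal `α`. -/
def Stable (Γ : LimitOperator.{u} n) : Prop :=
  ∀ (x : ℕ → Fin n) (α : Ordinal.{u}), Order.IsSuccLimit α → Γ (OrdWord.const x α) = x

/-- The limit value of a cell is a function, the same for all cells, of the history of that
cell. -/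
def CellByCell (Γ : LimitOperator.{u} n) : Prop :=
  ∃ γ : OrdWord.{u} (Fin n) → Fin n, ∀ H : OrdWord.{u} (ℕ → Fin n), H.IsLimit →
    ∀ c : ℕ, γ (H.map fun x => x c) = Γ H c

/-- A limit history and any of its non-empty final segments have the same limit. -/
def Asymptotic (Γ : LimitOperator.{u} n) : Prop :=
  ∀ H H' : OrdWord.{u} (ℕ → Fin n), H.IsLimit → H'.IsFinalSegment H → 0 < H'.len → Γ H = Γ H'

/-- Limit histories that are equal after contraction have the same limit. -/
def ContractionProof (Γ : LimitOperator.{u} n) : Prop :=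
  ∀ H H' : OrdWord.{u} (ℕ → Fin n), H.IsLimit → H'.IsLimit → H.ctr = H'.ctr → Γ H = Γ H'

/-- Simulational operators. -/
structure Simulational (Γ : LimitOperator.{u} n) : Prop where
  stable : Γ.Stable
  cellByCell : Γ.CellByCell
  asymptotic : Γ.Asymptotic
  contractionProof : Γ.ContractionProof

/-- Looping stability: `Γ (H ^ α) = Γ (H ^ α')` for every limit history `H` and all limit ordinals
`α` and `α'`. -/
def LoopingStable (Γ : LimitOperator.{u} n) : Prop :=
  ∀ (H : OrdWord.{u} (ℕ → Fin n)) (α α' : Ordinal.{u}), H.IsLimit → Order.IsSuccLimit α →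
    Order.IsSuccLimit α' → Γ (H.rep α) = Γ (H.rep α')

/-- The operator `Γ` after renaming each symbol `s` to `σ s`. -/
def rename (σ : Equiv.Perm (Fin n)) (Γ : LimitOperator.{u} n) : LimitOperator.{u} n :=
  fun H c => σ (Γ (H.map fun x d => σ.symm (x d)) c)

open Classical in
/-- The two-symbol `limsup` operator: the value of a cell is `0` if and only if the cell has
stabilized on `0`. -/
noncomputable def sup : LimitOperator.{u} 2 := fun H c =>
  if ∃ β < H.len, ∀ (δ : Ordinal.{u}) (hδ : δ < H.len), β ≤ δ → H.get δ hδ c = 0 then 0 else 1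

end LimitOperator

/-! ### Machines -/

/-- Moves of the head. -/
inductive Move : Type
  | left
  | stay
  | right

/-- A position of the head after a move (a left move on the first cell leaves the head there). -/
def Move.apply : Move → ℕ → ℕ
  | .left, h => h - 1
  | .stay, h => h
  | .right, h => h + 1

/-- (The program of) an `n`-symbol infinite time Turing machine: the structure of a finite Turing
machine with three tapes (input, working, output), whose head reads and writes the three
cells at its position at once, and with a distinguished limit state. -/
structure Machine (n : ℕ) : Type 1 where
  /-- the states -/
  State : Type
  finite : Finite State
  start : State
  limit : State
  halt : State
  /-- from the state and the three symbols read: the new state, the three symbols to write and the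
  move of the head -/
  trans : State → (Fin 3 → Fin n) → State × (Fin 3 → Fin n) × Move

/-- The cell of index `i` on the tape `t` is the cell `3 * i + t` of the single word of length `ω`
that represents the three tapes. -/
def cell (t : Fin 3) (i : ℕ) : ℕ := 3 * i + t

/-- A snapshot, with set of states `Q`: state, head position, content of the three tapes (coded in
a single word by `cell`). -/
@[ext]
structure Snapshot (n : ℕ) (Q : Type) : Type where
  state : Q
  head : ℕ
  tape : ℕ → Fin n

namespace Machine

variable {n : ℕ}

/-- The initial snapshot on the input `y`: start state, head on the first cell, `y` on the input
tape `0`, and blank symbols `0` on the two other tapes. -/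
def init [NeZero n] (M : Machine n) (y : ℕ → Fin n) : Snapshot n M.State where
  state := M.start
  head := 0
  tape c := if c % 3 = 0 then y (c / 3) else 0

open Classical in
/-- One step of computation; nothing changes once the machine is in its halting state. -/
noncomputable def step (M : Machine n) (s : Snapshot n M.State) : Snapshot n M.State :=
  if s.state = M.halt then s
  else
    let r := M.trans s.state fun t => s.tape (cell t s.head)
    { state := r.1
      head := r.2.2.apply s.head
      tape := fun c => if c / 3 = s.head then r.2.1 (Fin.ofNat 3 c) else s.tape c }

open Classical in
/-- The snapshot at stage `α` of the computation of `M`, as a `Γ`-machine, on the input `y`. At a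
limit stage the head is on the first cell, the state is the limit state, and the tapes are given
by `Γ` applied to the history of the tapes. By convention, a machine that has halted keeps its
halting snapshot at all later stages, limit stages included. -/
noncomputable def run [NeZero n] (M : Machine n) (Γ : LimitOperator.{u} n) (y : ℕ → Fin n)
    (α : Ordinal.{u}) : Snapshot n M.State :=
  Ordinal.limitRecOn (motive := fun _ => Snapshot n M.State) α
    (M.init y)
    (fun _ s => M.step s)
    (fun μ _ prev =>
      if h : ∃ (β : Ordinal.{u}) (hβ : β < μ), (prev β hβ).state = M.halt then
        prev h.choose h.choose_spec.choose
      else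
        { state := M.limit
          head := 0
          tape := Γ ⟨μ, fun β hβ => (prev β hβ).tape⟩ })

end Machine

/-! ### Emulation -/

/-- A snapshot `s` with `k` symbols and a snapshot `s'` with `n ≥ k` symbols match: same state (via
the inclusion `ι` of the states), same head position, same tapes. -/
def Snapshot.Matches {k n : ℕ} {Q Q' : Type} (h : k ≤ n) (ι : Q → Q') (s : Snapshot k Q)
    (s' : Snapshot n Q') : Prop :=
  s'.state = ι s.state ∧ s'.head = s.head ∧ ∀ c, s'.tape c = Fin.castLE h (s.tape c)

/-- The `n`-symbol operator `Γn` emulates the `k`-symbol operator `Γk`: for each `Γk`-machine `M`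
there is a `Γn`-machine `N`, whose states include those of `M`, such that on every input

* the snapshots of `M` and `N` match at every limit stage;
* between a stage `μ` that is `0` or limit and the next limit stage, the snapshots of `M` appear in
  `N` in the same order (the `j`-th one as the `φ j`-th one), hence separated by finitely many
  snapshots;
* all the other snapshots of `N` have a symbol `s ∉ k` in one of their cells. -/
def Emulates {k n : ℕ} [NeZero k] [NeZero n] (h : k ≤ n) (Γn : LimitOperator.{u} n)
    (Γk : LimitOperator.{u} k) : Prop :=
  ∀ M : Machine k, ∃ (N : Machine n) (ι : M.State → N.State),
    Function.Injective ι ∧ ι M.start = N.start ∧ ι M.limit = N.limit ∧ ι M.halt = N.halt ∧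
    ∀ y : ℕ → Fin k,
      (∀ μ : Ordinal.{u}, Order.IsSuccLimit μ →
        (M.run Γk y μ).Matches h ι (N.run Γn (fun i => Fin.castLE h (y i)) μ)) ∧
      ∀ μ : Ordinal.{u}, μ = 0 ∨ Order.IsSuccLimit μ →
        ∃ φ : ℕ → ℕ, StrictMono φ ∧ φ 0 = 0 ∧
          (∀ j : ℕ, (M.run Γk y (μ + j)).Matches h ι
            (N.run Γn (fun i => Fin.castLE h (y i)) (μ + φ j))) ∧
          ∀ i : ℕ, i ∉ Set.range φ →
            ∃ c : ℕ, k ≤ ((N.run Γn (fun i => Fin.castLE h (y i)) (μ + i)).tape c : ℕ)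

end InfTM

/-!
A history that moves through the symbols in cyclic order, staying or advancing by one at each stage
and taking a fixed value `s` wherever it has not stabilized, contracts to an initial segment of the
cycle `a, a + 1, a + 2, …` restarted at `s` at every limit, where one may take `a = s` by dropping
finitely many letters. If all letters of the cycle are repeated `ω` times, then its initial segments
of limit length are powers of a single limit word. So looping stability gives them all the same
limit, and since the value at limits cannot be seen in the shortest of them, this limit can be
computed before choosing `s` and then be taken for `s`.

After a renaming, `s = 1`. A two-symbol machine is simulated by letting each cell that falls from
`1` to `0` go through `2, …, n - 1` first. Then each cell of the simulator has a history as above: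
where it has not stabilized it receives `1`, its limit superior in the simulated computation.
-/

namespace InfTM

open Order Ordinal

variable {A B : Type}

/-! ### Eventual values and jumps -/

/-- `f` has the eventual value `x` below `i`. At a successor `i = κ + 1` this says `f κ = x`, and at
`0` it is false. -/
def StabilizesAt (f : Ordinal.{u} → A) (i : Ordinal.{u}) (x : A) : Prop :=
  ∃ κ < i, ∀ ξ, κ ≤ ξ → ξ < i → f ξ = x

/-- `f` does not take at `i` the value that it has just before `i`: a block of equal values of `f`
starts at `i`. -/
def IsJump (f : Ordinal.{u} → A) (i : Ordinal.{u}) : Prop :=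
  ¬ StabilizesAt f i (f i)

theorem StabilizesAt.unique {f : Ordinal.{u} → A} {i : Ordinal.{u}} {x x' : A}
    (h : StabilizesAt f i x) (h' : StabilizesAt f i x') : x = x' := by
  obtain ⟨κ, hκ, hx⟩ := h
  obtain ⟨κ', hκ', hx'⟩ := h'
  have hmax : max κ κ' < i := max_lt hκ hκ'
  rw [← hx _ (le_max_left _ _) hmax, hx' _ (le_max_right _ _) hmax]

theorem not_stabilizesAt_zero (f : Ordinal.{u} → A) (x : A) : ¬ StabilizesAt f 0 x :=
  fun ⟨_, hκ, _⟩ => not_lt.2 zero_le hκ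

theorem stabilizesAt_add_one {f : Ordinal.{u} → A} {i : Ordinal.{u}} {x : A} :
    StabilizesAt f (i + 1) x ↔ f i = x := by
  refine ⟨fun ⟨κ, hκ, hx⟩ => hx i (lt_add_one_iff.1 hκ) (lt_add_one i), fun hx => ?_⟩
  refine ⟨i, lt_add_one i, fun ξ h h' => ?_⟩
  rwa [(lt_add_one_iff.1 h').antisymm h]

theorem StabilizesAt.comp {f : Ordinal.{u} → A} {i : Ordinal.{u}} {x : A}
    (h : StabilizesAt f i x) (e : A → B) : StabilizesAt (e ∘ f) i (e x) :=
  let ⟨κ, hκ, hx⟩ := h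
  ⟨κ, hκ, fun ξ h₁ h₂ => congrArg e (hx ξ h₁ h₂)⟩

theorem StabilizesAt.of_comp {f : Ordinal.{u} → A} {i : Ordinal.{u}} {e : A → B}
    (he : Function.Injective e) {z : B} (h : StabilizesAt (e ∘ f) i z) :
    ∃ x, e x = z ∧ StabilizesAt f i x :=
  let ⟨κ, hκ, hz⟩ := h
  ⟨f κ, hz κ le_rfl hκ, κ, hκ, fun ξ h₁ h₂ => he ((hz ξ h₁ h₂).trans (hz κ le_rfl hκ).symm)⟩

theorem isJump_zero (f : Ordinal.{u} → A) : IsJump f 0 :=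
  not_stabilizesAt_zero f _

theorem isJump_add_one {f : Ordinal.{u} → A} {i : Ordinal.{u}} :
    IsJump f (i + 1) ↔ f i ≠ f (i + 1) :=
  stabilizesAt_add_one.not

theorem exists_isJump_le (f : Ordinal.{u} → A) (i : Ordinal.{u}) :
    ∃ β ≤ i, IsJump f β ∧ ∀ ξ, β ≤ ξ → ξ ≤ i → f ξ = f i := by
  induction i using WellFoundedLT.induction with
  | ind i ih =>
    by_cases hi : IsJump f i
    · exact ⟨i, le_rfl, hi, fun ξ h h' => by rw [h'.antisymm h]⟩
    obtain ⟨κ, hκ, hconst⟩ := not_not.1 hi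
    obtain ⟨β, hβ, hjump, hβκ⟩ := ih κ hκ
    refine ⟨β, hβ.trans hκ.le, hjump, fun ξ h h' => ?_⟩
    rcases lt_or_ge ξ κ with hξκ | hκξ
    · rw [hβκ ξ h hξκ.le, hconst κ le_rfl hκ]
    · rcases h'.eq_or_lt with rfl | hξi
      exacts [rfl, hconst ξ hκξ hξi]

namespace OrdWord

/-- The word of length `μ` whose letters are the values of `f`. -/
def restrict (f : Ordinal.{u} → A) (μ : Ordinal.{u}) : OrdWord.{u} A where
  len := μ
  get i _ := f i

theorem restrict_congr {f g : Ordinal.{u} → A} {μ : Ordinal.{u}} (h : ∀ i < μ, f i = g i) :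
    restrict f μ = restrict g μ :=
  OrdWord.ext rfl (heq_of_eq (funext₂ h))

theorem isBlockStart_restrict {f : Ordinal.{u} → A} {μ i : Ordinal.{u}} {hi : i < μ} :
    (restrict f μ).IsBlockStart i hi ↔ IsJump f i := by
  simp only [IsBlockStart, IsJump, StabilizesAt, restrict]
  push Not
  exact forall₂_congr fun κ _ => exists_congr fun ξ =>
    ⟨fun ⟨h₁, h₂, h₃⟩ => ⟨h₂, h₁, h₃⟩, fun ⟨h₂, h₁, h₃⟩ => ⟨h₁, h₂, h₃⟩⟩

theorem not_bddAbove_blockStarts (w : OrdWord.{u} A) :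
    ¬ BddAbove {i | ∀ hi : i < w.len, w.IsBlockStart i hi} := fun ⟨b, hb⟩ =>
  have hmem : max b w.len + 1 ∈ {i | ∀ hi : i < w.len, w.IsBlockStart i hi} := fun hlt =>
    absurd hlt (not_lt.2 ((le_max_right _ _).trans le_self_add))
  absurd (hb hmem) (not_le.2 ((le_max_left _ _).trans_lt (lt_add_one _)))

theorem blockSeq_strictMono (w : OrdWord.{u} A) : StrictMono w.blockSeq :=
  enumOrd_strictMono w.not_bddAbove_blockStarts

theorem blockSeq_zero (w : OrdWord.{u} A) : w.blockSeq 0 = 0 := by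
  rw [blockSeq, enumOrd_zero]
  exact le_antisymm (csInf_le' fun _ κ hκ => absurd hκ (not_lt.2 zero_le)) zero_le

theorem lt_len_ctr_iff {w : OrdWord.{u} A} {ν : Ordinal.{u}} :
    ν < w.ctr.len ↔ w.blockSeq ν < w.len := by
  refine ⟨fun h => lt_of_not_ge fun hle => notMem_of_lt_csInf' h hle, fun h => ?_⟩
  have hmem : w.len ≤ w.blockSeq w.ctr.len :=
    csInf_mem (s := {ν | w.len ≤ w.blockSeq ν}) ⟨_, le_enumOrd_self w.not_bddAbove_blockStarts⟩
  exact w.blockSeq_strictMono.lt_iff_lt.1 (h.trans_le hmem)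

section restrict

variable {f : Ordinal.{u} → A} {μ : Ordinal.{u}}

theorem isJump_blockSeq {ν : Ordinal.{u}} (h : (restrict f μ).blockSeq ν < μ) :
    IsJump f ((restrict f μ).blockSeq ν) :=
  isBlockStart_restrict.1 (enumOrd_mem (restrict f μ).not_bddAbove_blockStarts ν h)

theorem exists_blockSeq_eq {i : Ordinal.{u}} (h : IsJump f i) :
    ∃ ν, (restrict f μ).blockSeq ν = i :=
  enumOrd_surjective (restrict f μ).not_bddAbove_blockStarts fun _ => isBlockStart_restrict.2 h

theorem stabilizesAt_of_mem_block {i ν : Ordinal.{u}}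
    (hν : (restrict f μ).blockSeq ν < i) (hν' : i ≤ (restrict f μ).blockSeq (ν + 1)) :
    StabilizesAt f i (f ((restrict f μ).blockSeq ν)) := by
  have hmono := (restrict f μ).blockSeq_strictMono
  refine ⟨_, hν, fun ξ hνξ hξ => ?_⟩
  obtain ⟨β, hβξ, hβ, hconst⟩ := exists_isJump_le f ξ
  obtain ⟨δ, rfl⟩ := exists_blockSeq_eq (μ := μ) hβ
  have hδ : δ ≤ ν := lt_add_one_iff.1 (hmono.lt_iff_lt.1 (hβξ.trans_lt (hξ.trans_le hν')))
  exact (hconst _ (hmono.monotone hδ) hνξ).symm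

theorem exists_mem_block {i : Ordinal.{u}} {x : A} (hi : i ≤ μ) (h : StabilizesAt f i x) :
    ∃ ν, (restrict f μ).blockSeq ν < i ∧ i ≤ (restrict f μ).blockSeq (ν + 1) := by
  obtain ⟨κ, hκ, hx⟩ := h
  obtain ⟨β, hβκ, hβ, hconst⟩ := exists_isJump_le f κ
  have hβx : ∀ ξ, β ≤ ξ → ξ < i → f ξ = x := fun ξ hβξ hξ => by
    rcases le_total ξ κ with hξκ | hκξ
    · rw [hconst ξ hβξ hξκ, hx κ le_rfl hκ]
    · exact hx ξ hκξ hξ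
  obtain ⟨ν, rfl⟩ := exists_blockSeq_eq (μ := μ) hβ
  refine ⟨ν, hβκ.trans_lt hκ, le_of_not_gt fun hlt => ?_⟩
  have hν := (restrict f μ).blockSeq_strictMono (lt_add_one ν)
  refine isJump_blockSeq (hlt.trans_le hi) ⟨_, hν, fun ξ h h' => ?_⟩
  rw [hβx ξ h (h'.trans hlt), hβx _ hν.le hlt]

theorem isLimit_ctr_restrict (hμ : 0 < μ) (h : ∀ x, ¬ StabilizesAt f μ x) :
    (restrict f μ).ctr.IsLimit := by
  rcases zero_or_succ_or_isSuccLimit (restrict f μ).ctr.len with h₀ | ⟨ν, hν⟩ | hl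
  · have : 0 < (restrict f μ).ctr.len := lt_len_ctr_iff.2 (by rwa [blockSeq_zero])
    exact absurd h₀ this.ne'
  · have hν₁ : (restrict f μ).blockSeq ν < μ := lt_len_ctr_iff.1 (hν ▸ lt_succ ν)
    have hν₂ : μ ≤ (restrict f μ).blockSeq (ν + 1) :=
      not_lt.1 fun hlt => (lt_len_ctr_iff.2 hlt).ne hν
    exact absurd (stabilizesAt_of_mem_block hν₁ hν₂) (h _)
  · exact hl

end restrict

theorem ctr_restrict_comp {e : A → B} (he : Function.Injective e) (f : Ordinal.{u} → A)
    (μ : Ordinal.{u}) : (restrict (e ∘ f) μ).ctr = (restrict f μ).ctr.map e := by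
  have hseq : (restrict (e ∘ f) μ).blockSeq = (restrict f μ).blockSeq := by
    simp only [blockSeq, IsBlockStart, restrict, Function.comp_apply, he.ne_iff]
  have hctr : (restrict (e ∘ f) μ).ctr = restrict (e ∘ f ∘ (restrict (e ∘ f) μ).blockSeq)
      (sInf {ν | μ ≤ (restrict (e ∘ f) μ).blockSeq ν}) := rfl
  rw [hctr, hseq]
  rfl

end OrdWord

/-! ### Cycles and walks -/

/-- The sequence that starts with `a`, moves on by `next` at successors and takes the value `base`
at limits. -/
noncomputable def cycle (next : A → A) (base a : A) (i : Ordinal.{u}) : A :=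
  limitRecOn (motive := fun _ => A) i a (fun _ x => next x) fun _ _ _ => base

/-- Below `μ`, the sequence `f` keeps its eventual value or moves on by `next`, and it takes the
value `base` wherever there is no eventual value. -/
structure IsWalk (next : A → A) (base : A) (f : Ordinal.{u} → A) (μ : Ordinal.{u}) : Prop where
  eq_or_eq_next : ∀ i < μ, ∀ x, StabilizesAt f i x → f i = x ∨ f i = next x
  eq_base : ∀ i < μ, 0 < i → (∀ x, ¬ StabilizesAt f i x) → f i = base

section cycle

variable (next : A → A) (base a : A)

theorem cycle_zero : cycle next base a (0 : Ordinal.{u}) = a :=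
  limitRecOn_zero ..

theorem cycle_add_one (i : Ordinal.{u}) :
    cycle next base a (i + 1) = next (cycle next base a i) :=
  limitRecOn_add_one ..

variable {next base} in
theorem cycle_limit {i : Ordinal.{u}} (hi : IsSuccLimit i) : cycle next base a i = base :=
  limitRecOn_limit (h := hi) ..

theorem cycle_add (i j : Ordinal.{u}) :
    cycle next base a (i + j) = cycle next base (cycle next base a i) j := by
  induction j using limitRecOn with
  | zero => rw [add_zero, cycle_zero]
  | add_one j ih => rw [← add_assoc, cycle_add_one, cycle_add_one, ih]
  | limit j hj _ => rw [cycle_limit _ (isSuccLimit_add i hj), cycle_limit _ hj]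

theorem cycle_natCast (k : ℕ) : cycle next base a (k : Ordinal.{u}) = next^[k] a := by
  induction k with
  | zero => rw [Nat.cast_zero, cycle_zero, Function.iterate_zero_apply]
  | succ k ih => rw [Nat.cast_add_one, cycle_add_one, ih, Function.iterate_succ_apply']

variable {next} in
theorem isJump_cycle (hnext : ∀ x, next x ≠ x) (i : Ordinal.{u}) :
    IsJump (cycle next base a) i := by
  induction i using limitRecOn with
  | zero => exact isJump_zero _
  | add_one i _ =>
    rw [isJump_add_one, cycle_add_one]
    exact (hnext _).symm
  | limit i hi _ =>
    rintro ⟨κ, hκ, hconst⟩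
    apply hnext (cycle next base a κ)
    rw [← cycle_add_one next base a κ, hconst κ le_rfl hκ,
      hconst _ le_self_add (hi.add_one_lt hκ)]

variable {next base} in
theorem cycle_natCast_mul {n : ℕ} (hn : 0 < n) (hbase : next^[n] base = base) (i : Ordinal.{u}) :
    cycle next base base (n * i) = base := by
  induction i using limitRecOn with
  | zero => rw [mul_zero, cycle_zero]
  | add_one i ih => rw [mul_add_one, cycle_add, ih, cycle_natCast, hbase]
  | limit i hi _ => exact cycle_limit _ (isSuccLimit_mul_right (mod_cast hn) hi)

variable {next base} in
theorem cycle_mod_natCast {n : ℕ} (hn : 0 < n) (hbase : next^[n] base = base) (i : Ordinal.{u}) :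
    cycle next base base (i % n) = cycle next base base i := by
  conv_rhs => rw [← div_add_mod i n, cycle_add, cycle_natCast_mul hn hbase]

end cycle

theorem IsWalk.comp {next : A → A} {next' : B → B} {base : A} {f : Ordinal.{u} → A}
    {μ : Ordinal.{u}} (h : IsWalk next base f μ) {e : A → B} (he : Function.Injective e)
    (hnext : ∀ x, e (next x) = next' (e x)) : IsWalk next' (e base) (e ∘ f) μ where
  eq_or_eq_next i hi z hz := by
    obtain ⟨x, rfl, hx⟩ := hz.of_comp he
    rw [← hnext]
    exact (h.eq_or_eq_next i hi x hx).imp (congrArg e) (congrArg e)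
  eq_base i hi hpos hnot := congrArg e (h.eq_base i hi hpos fun x hx => hnot _ (hx.comp e))

theorem IsWalk.apply_blockSeq {next : A → A} {base : A} {f : Ordinal.{u} → A} {μ : Ordinal.{u}}
    (h : IsWalk next base f μ) (ν : Ordinal.{u}) (hν : (OrdWord.restrict f μ).blockSeq ν < μ) :
    f ((OrdWord.restrict f μ).blockSeq ν) = cycle next base (f 0) ν := by
  have hmono := (OrdWord.restrict f μ).blockSeq_strictMono
  induction ν using limitRecOn with
  | zero => rw [OrdWord.blockSeq_zero, cycle_zero]
  | add_one ν ih =>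
    have hlt := hmono (lt_add_one ν)
    have hstab := OrdWord.stabilizesAt_of_mem_block hlt le_rfl
    rw [cycle_add_one, ← ih (hlt.trans hν)]
    refine (h.eq_or_eq_next _ hν _ hstab).resolve_left fun heq => ?_
    exact OrdWord.isJump_blockSeq hν (heq ▸ hstab)
  | limit ν hl _ =>
    rw [cycle_limit _ hl]
    refine h.eq_base _ hν (zero_le.trans_lt (hmono hl.bot_lt)) fun x hx => ?_
    obtain ⟨δ, hδν, hνδ⟩ := OrdWord.exists_mem_block hν.le hx
    exact (hmono (hl.add_one_lt (hmono.lt_iff_lt.1 hδν))).not_ge hνδ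

theorem IsWalk.ctr_restrict {next : A → A} {base : A} {f : Ordinal.{u} → A} {μ : Ordinal.{u}}
    (h : IsWalk next base f μ) : (OrdWord.restrict f μ).ctr =
      OrdWord.restrict (cycle next base (f 0)) (OrdWord.restrict f μ).ctr.len :=
  OrdWord.restrict_congr (f := f ∘ (OrdWord.restrict f μ).blockSeq) fun ν hν =>
    h.apply_blockSeq ν (OrdWord.lt_len_ctr_iff.1 hν)

/-! ### Slow sequences -/

/-- The sequence in which each value of `f` is repeated `ω` times. -/
noncomputable def slow (f : Ordinal.{u} → A) (i : Ordinal.{u}) : A :=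
  f (i / ω)

theorem stabilizesAt_slow_omega0_mul {f : Ordinal.{u} → A} {i : Ordinal.{u}} {x : A} :
    StabilizesAt (slow f) (ω * i) x ↔ StabilizesAt f i x := by
  have hdiv {ξ ζ : Ordinal.{u}} : ξ < ω * ζ ↔ ξ / ω < ζ := lt_mul_iff_div_lt omega0_ne_zero
  have hmul {ξ ζ : Ordinal.{u}} : ω * ζ ≤ ξ ↔ ζ ≤ ξ / ω := mul_le_iff_le_div omega0_ne_zero
  constructor
  · rintro ⟨κ, hκ, hx⟩
    refine ⟨κ / ω, hdiv.1 hκ, fun ξ hκξ hξ => ?_⟩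
    have hlt : max κ (ω * ξ) < ω * (ξ + 1) :=
      max_lt (hdiv.2 (lt_add_one_iff.2 hκξ)) (mul_lt_mul_of_pos_left (lt_add_one ξ) omega0_pos)
    have hξ_eq : max κ (ω * ξ) / ω = ξ :=
      (lt_add_one_iff.1 (hdiv.1 hlt)).antisymm (hmul.1 (le_max_right _ _))
    rw [← hx _ (le_max_left _ _) (max_lt hκ (mul_lt_mul_of_pos_left hξ omega0_pos)), slow, hξ_eq]
  · rintro ⟨κ, hκ, hx⟩
    exact ⟨ω * κ, mul_lt_mul_of_pos_left hκ omega0_pos, fun ξ h h' =>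
      hx _ (hmul.1 h) (hdiv.1 h')⟩

theorem slow_omega0_mul (f : Ordinal.{u} → A) (i : Ordinal.{u}) : slow f (ω * i) = f i := by
  rw [slow, mul_div_cancel _ omega0_ne_zero]

theorem isJump_slow_iff {f : Ordinal.{u} → A} (hf : ∀ i, IsJump f i) {i : Ordinal.{u}} :
    IsJump (slow f) i ↔ ∃ ν, ω * ν = i := by
  constructor
  · intro hi
    refine ⟨i / ω, (mul_div_le _ _).eq_of_not_lt fun hlt => hi ⟨_, hlt, fun ξ h h' => ?_⟩⟩
    rw [slow, slow, (div_le_left h'.le ω).antisymm ((mul_le_iff_le_div omega0_ne_zero).1 h)]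
  · rintro ⟨ν, rfl⟩
    rw [IsJump, slow_omega0_mul, stabilizesAt_slow_omega0_mul]
    exact hf ν

theorem blockSeq_restrict_slow {f : Ordinal.{u} → A} (hf : ∀ i, IsJump f i) {μ ν : Ordinal.{u}}
    (hν : ν ≤ μ) : (OrdWord.restrict (slow f) (ω * μ)).blockSeq ν = ω * ν := by
  have hmono := (OrdWord.restrict (slow f) (ω * μ)).blockSeq_strictMono
  induction ν using WellFoundedLT.induction with
  | ind ν ih =>
    refine le_antisymm (enumOrd_le_of_forall_lt (fun _ => ?_) fun δ hδ => ?_) ?_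
    · exact OrdWord.isBlockStart_restrict.2 ((isJump_slow_iff hf).2 ⟨ν, rfl⟩)
    · exact (ih δ hδ (hδ.le.trans hν)).trans_lt (mul_lt_mul_of_pos_left hδ omega0_pos)
    · refine not_lt.1 fun hlt => ?_
      have hjump := OrdWord.isJump_blockSeq (hlt.trans_le (mul_le_mul_right hν ω))
      obtain ⟨δ, hδ⟩ := (isJump_slow_iff hf).1 hjump
      have hδν : δ < ν := lt_of_mul_lt_mul_left' (hδ ▸ hlt)
      exact hδν.ne (hmono.injective ((ih δ hδν (hδν.le.trans hν)).trans hδ))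

theorem ctr_restrict_slow {f : Ordinal.{u} → A} (hf : ∀ i, IsJump f i) (μ : Ordinal.{u}) :
    (OrdWord.restrict (slow f) (ω * μ)).ctr = OrdWord.restrict f μ := by
  set w := OrdWord.restrict (slow f) (ω * μ)
  have hlen : w.ctr.len = μ := eq_of_forall_lt_iff fun ν => by
    have hμ : w.blockSeq μ = w.len := blockSeq_restrict_slow hf le_rfl
    rw [OrdWord.lt_len_ctr_iff, ← hμ, w.blockSeq_strictMono.lt_iff_lt]
  have hctr : w.ctr = OrdWord.restrict (slow f ∘ w.blockSeq) w.ctr.len := rfl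
  rw [hctr, hlen]
  refine OrdWord.restrict_congr fun ν hν => ?_
  rw [Function.comp_apply, blockSeq_restrict_slow hf hν.le, slow_omega0_mul]

theorem mod_mul_div {a b : Ordinal.{u}} (ha : a ≠ 0) (hb : b ≠ 0) (i : Ordinal.{u}) :
    i % (a * b) / a = i / a % b := by
  have hlt : i % (a * b) / a < b := (lt_mul_iff_div_lt ha).1 (mod_lt i (mul_ne_zero ha hb))
  conv_rhs => rw [← div_add_mod i (a * b), mul_assoc, mul_add_div _ ha, mul_add_mod_self]
  exact (mod_eq_of_lt hlt).symm

theorem natCast_mul_of_isSuccLimit {n : ℕ} (hn : 0 < n) {α : Ordinal.{u}} (hα : IsSuccLimit α) :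
    n * α = α := by
  obtain ⟨δ, rfl⟩ := isSuccPrelimit_iff_omega0_dvd.1 hα.isSuccPrelimit
  rw [← mul_assoc, natCast_mul_omega0 hn]

theorem rep_restrict_slow_cycle {next : A → A} {base : A} {n : ℕ} (hn : 0 < n)
    (hbase : next^[n] base = base) {α : Ordinal.{u}} (hα : IsSuccLimit α) :
    (OrdWord.restrict (slow (cycle next base base)) (ω * n)).rep α =
      OrdWord.restrict (slow (cycle next base base)) (ω * α) := by
  have hn₀ : (n : Ordinal.{u}) ≠ 0 := Nat.cast_ne_zero.2 hn.ne'
  conv_rhs => rw [← natCast_mul_of_isSuccLimit hn hα, ← mul_assoc]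
  refine OrdWord.restrict_congr (f := fun i => slow (cycle next base base) (i % (ω * n)))
    fun i _ => ?_
  rw [slow, slow, mod_mul_div omega0_ne_zero hn₀, cycle_mod_natCast hn hbase]

/-! ### Cell rules -/

open Fin.CommRing in
theorem iterate_add_one_self {n : ℕ} [NeZero n] (x : Fin n) : (· + 1)^[n] x = x := by
  simp only [add_right_iterate, nsmul_one, Fin.natCast_self, add_zero]

open Fin.CommRing in
theorem exists_iterate_add_one_eq {n : ℕ} [NeZero n] (x y : Fin n) :
    ∃ k : ℕ, (· + 1)^[k] x = y :=
  ⟨(y - x).val, by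
    simp only [add_right_iterate, nsmul_one, Fin.cast_val_eq_self, _root_.add_sub_cancel]⟩

namespace LimitOperator

open OrdWord (restrict)

variable {n : ℕ} {Γ : LimitOperator.{u} n}

/-- The limit rule for the history of a single cell, read off from histories in which all the cells
agree. It describes `Γ` when `Γ` is cell-by-cell. -/
def cellRule (Γ : LimitOperator.{u} n) (w : OrdWord.{u} (Fin n)) : Fin n :=
  Γ (w.map fun x _ => x) 0

theorem CellByCell.apply_eq_cellRule (h : Γ.CellByCell) {F : Ordinal.{u} → ℕ → Fin n}
    {μ : Ordinal.{u}} (hμ : IsSuccLimit μ) (c : ℕ) :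
    Γ (restrict F μ) c = Γ.cellRule (restrict (F · c) μ) := by
  obtain ⟨γ, hγ⟩ := h
  exact (hγ (restrict F μ) hμ c).symm.trans (hγ (restrict (fun i _ => F i c) μ) hμ 0)

theorem Stable.cellRule_const (h : Γ.Stable) {α : Ordinal.{u}} (hα : IsSuccLimit α) (x : Fin n) :
    Γ.cellRule (restrict (fun _ => x) α) = x :=
  congrFun (h (fun _ => x) α hα) 0

theorem Asymptotic.cellRule_restrict_add (h : Γ.Asymptotic) (f : Ordinal.{u} → Fin n)
    (α : Ordinal.{u}) {μ : Ordinal.{u}} (hμ : IsSuccLimit μ) :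
    Γ.cellRule (restrict f (α + μ)) = Γ.cellRule (restrict (fun i => f (α + i)) μ) :=
  congrFun (h (restrict (fun i _ => f i) (α + μ)) (restrict (fun i _ => f (α + i)) μ)
    (isSuccLimit_add α hμ) ⟨α, rfl, fun _ _ _ => rfl⟩ hμ.bot_lt) 0

theorem ContractionProof.cellRule_congr (h : Γ.ContractionProof) {f g : Ordinal.{u} → Fin n}
    {μ ν : Ordinal.{u}} (hμ : IsSuccLimit μ) (hν : IsSuccLimit ν)
    (hctr : (restrict f μ).ctr = (restrict g ν).ctr) :
    Γ.cellRule (restrict f μ) = Γ.cellRule (restrict g ν) := by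
  have hinj : Function.Injective fun (x : Fin n) (_ : ℕ) => x := Function.const_injective
  refine congrFun (h (restrict ((fun x _ => x) ∘ f) μ) (restrict ((fun x _ => x) ∘ g) ν) hμ hν ?_) 0
  rw [OrdWord.ctr_restrict_comp hinj, OrdWord.ctr_restrict_comp hinj, hctr]

theorem LoopingStable.cellRule_rep (h : Γ.LoopingStable) {w : OrdWord.{u} (Fin n)}
    (hw : w.IsLimit) {α α' : Ordinal.{u}} (hα : IsSuccLimit α) (hα' : IsSuccLimit α') :
    Γ.cellRule (w.rep α) = Γ.cellRule (w.rep α') :=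
  congrFun (h (w.map fun x _ => x) α α' hw hα hα') 0

theorem Simulational.cellRule_of_stabilizesAt (h : Γ.Simulational) {f : Ordinal.{u} → Fin n}
    {μ : Ordinal.{u}} (hμ : IsSuccLimit μ) {x : Fin n} (hx : StabilizesAt f μ x) :
    Γ.cellRule (restrict f μ) = x := by
  obtain ⟨κ, hκ, hconst⟩ := hx
  have hlim : IsSuccLimit (μ - κ) := isSuccLimit_sub hμ.isSuccPrelimit hκ
  rw [← Ordinal.add_sub_cancel_of_le hκ.le, h.asymptotic.cellRule_restrict_add f κ hlim,
    ← h.stable.cellRule_const hlim x]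
  exact congrArg _ (OrdWord.restrict_congr fun i hi => hconst _ le_self_add (lt_sub.1 hi))

section cycle

variable {next : Fin n → Fin n} {base : Fin n}

/-- Dropping the first `ω * k` letters of a slow cycle advances its first value `k` times. -/
theorem Asymptotic.cellRule_slow_cycle_iterate (h : Γ.Asymptotic) (a : Fin n) (k : ℕ)
    {α : Ordinal.{u}} (hα : IsSuccLimit α) :
    Γ.cellRule (restrict (slow (cycle next base (next^[k] a))) (ω * α)) =
      Γ.cellRule (restrict (slow (cycle next base a)) (ω * α)) := by
  have hα_eq : (k : Ordinal.{u}) + α = α :=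
    natCast_add_of_omega0_le (omega0_le_of_isSuccLimit hα) k
  have hlim : IsSuccLimit (ω * α) := isSuccLimit_mul_left isSuccLimit_omega0 hα.bot_lt
  conv_rhs => rw [← hα_eq, mul_add, h.cellRule_restrict_add _ _ hlim]
  refine congrArg _ (OrdWord.restrict_congr fun i _ => ?_)
  rw [slow, slow, mul_add_div _ omega0_ne_zero, cycle_add, cycle_natCast]

theorem LoopingStable.cellRule_slow_cycle (h : Γ.LoopingStable) {k : ℕ} (hk : 0 < k)
    (hbase : next^[k] base = base) {α α' : Ordinal.{u}} (hα : IsSuccLimit α)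
    (hα' : IsSuccLimit α') :
    Γ.cellRule (restrict (slow (cycle next base base)) (ω * α)) =
      Γ.cellRule (restrict (slow (cycle next base base)) (ω * α')) := by
  have hlim : (restrict (slow (cycle next base base)) (ω * (k : Ordinal.{u}))).IsLimit :=
    isSuccLimit_mul_left isSuccLimit_omega0 (mod_cast hk)
  rw [← rep_restrict_slow_cycle hk hbase hα, ← rep_restrict_slow_cycle hk hbase hα']
  exact h.cellRule_rep hlim hα hα'

/-- On words of length `ω * ω` the value at limits plays no role. -/
theorem cellRule_slow_cycle_base (base' a : Fin n) :
    Γ.cellRule (restrict (slow (cycle next base a)) (ω * ω)) =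
      Γ.cellRule (restrict (slow (cycle next base' a)) (ω * ω)) := by
  refine congrArg _ (OrdWord.restrict_congr fun i hi => ?_)
  obtain ⟨k, hk⟩ := lt_omega0.1 ((lt_mul_iff_div_lt omega0_ne_zero).1 hi)
  rw [slow, slow, hk, cycle_natCast, cycle_natCast]

theorem ContractionProof.cellRule_of_isWalk (h : Γ.ContractionProof) (hnext : ∀ x, next x ≠ x)
    {f : Ordinal.{u} → Fin n} {μ : Ordinal.{u}} (hμ : IsSuccLimit μ) (hf : IsWalk next base f μ)
    (hnot : ∀ x, ¬ StabilizesAt f μ x) :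
    ∃ α, IsSuccLimit α ∧ Γ.cellRule (restrict f μ) =
      Γ.cellRule (restrict (slow (cycle next base (f 0))) (ω * α)) := by
  have hlim := OrdWord.isLimit_ctr_restrict hμ.bot_lt hnot
  refine ⟨_, hlim, h.cellRule_congr hμ (isSuccLimit_mul_left isSuccLimit_omega0 hlim.bot_lt) ?_⟩
  rw [ctr_restrict_slow (isJump_cycle base (f 0) hnext), ← hf.ctr_restrict]

end cycle

theorem Simulational.exists_cellRule_of_isWalk [NeZero n] (h : Γ.Simulational)
    (hloop : Γ.LoopingStable) (hn : 2 ≤ n) :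
    ∃ s, ∀ {f : Ordinal.{u} → Fin n} {μ : Ordinal.{u}}, IsSuccLimit μ → IsWalk (· + 1) s f μ →
      (∀ x, ¬ StabilizesAt f μ x) → Γ.cellRule (restrict f μ) = s := by
  have hnext (x : Fin n) : x + 1 ≠ x := by
    rw [Ne, add_eq_left, Fin.one_eq_zero_iff]
    lia
  obtain ⟨s, hs⟩ : ∃ s, Γ.cellRule (restrict (slow (cycle (· + 1) 0 0)) (ω * ω)) = s := ⟨_, rfl⟩
  refine ⟨s, fun {f μ} hμ hf hnot => ?_⟩
  obtain ⟨α, hα, hfα⟩ := h.contractionProof.cellRule_of_isWalk hnext hμ hf hnot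
  obtain ⟨k, hk⟩ := exists_iterate_add_one_eq s (f 0)
  obtain ⟨l, hl⟩ := exists_iterate_add_one_eq 0 s
  calc Γ.cellRule (restrict f μ)
      = Γ.cellRule (restrict (slow (cycle (· + 1) s s)) (ω * α)) := by
        rw [hfα, ← hk, h.asymptotic.cellRule_slow_cycle_iterate s k hα]
    _ = Γ.cellRule (restrict (slow (cycle (· + 1) s s)) (ω * ω)) :=
        hloop.cellRule_slow_cycle (Nat.zero_lt_of_lt hn) (iterate_add_one_self s) hα
          isSuccLimit_omega0
    _ = Γ.cellRule (restrict (slow (cycle (· + 1) 0 0)) (ω * ω)) := by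
        rw [cellRule_slow_cycle_base 0 s, ← hl,
          h.asymptotic.cellRule_slow_cycle_iterate 0 l isSuccLimit_omega0]
    _ = s := hs

/-- `Γ` computes the limit superior of a cell whose history walks through the symbols in the cyclic
order `0, 1, …, n - 1` and shows `1` at each stage below which the cell does not stabilize. -/
structure IsSupOnWalks [NeZero n] (Γ : LimitOperator.{u} n) : Prop where
  of_stabilizesAt : ∀ {F : Ordinal.{u} → ℕ → Fin n} {μ : Ordinal.{u}} {c : ℕ} {x : Fin n},
    IsSuccLimit μ → StabilizesAt (F · c) μ x → Γ (restrict F μ) c = x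
  of_isWalk : ∀ {F : Ordinal.{u} → ℕ → Fin n} {μ : Ordinal.{u}} {c : ℕ}, IsSuccLimit μ →
    IsWalk (· + 1) 1 (F · c) μ → (∀ x, ¬ StabilizesAt (F · c) μ x) → Γ (restrict F μ) c = 1

theorem Simulational.exists_rename_isSupOnWalks [NeZero n] (h : Γ.Simulational)
    (hloop : Γ.LoopingStable) (hn : 2 ≤ n) :
    ∃ σ : Equiv.Perm (Fin n), (Γ.rename σ).IsSupOnWalks := by
  obtain ⟨s, hs⟩ := h.exists_cellRule_of_isWalk hloop hn
  let σ : Equiv.Perm (Fin n) := Equiv.addRight (1 - s)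
  have hsymm (x : Fin n) : σ.symm (x + 1) = σ.symm x + 1 := add_right_comm x 1 (-(1 - s))
  have hsymm_one : σ.symm 1 = s := σ.symm_apply_eq.2 (_root_.add_sub_cancel s 1).symm
  have hrename {F : Ordinal.{u} → ℕ → Fin n} {μ : Ordinal.{u}} {c : ℕ} (hμ : IsSuccLimit μ) :
      Γ.rename σ (restrict F μ) c = σ (Γ.cellRule (restrict (σ.symm ∘ (F · c)) μ)) :=
    congrArg σ (h.cellByCell.apply_eq_cellRule (F := fun i d => σ.symm (F i d)) hμ c)
  refine ⟨σ, fun {F μ c x} hμ hx => ?_, fun {F μ c} hμ hwalk hnot => ?_⟩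
  · rw [hrename hμ, h.cellRule_of_stabilizesAt hμ (hx.comp σ.symm), Equiv.apply_symm_apply]
  · have hwalk_symm := hwalk.comp (next' := (· + 1)) σ.symm.injective hsymm
    rw [hsymm_one] at hwalk_symm
    have hnot_symm (z : Fin n) : ¬ StabilizesAt (σ.symm ∘ (F · c)) μ z := fun hz =>
      let ⟨x, _, hx⟩ := hz.of_comp σ.symm.injective
      hnot x hx
    rw [hrename hμ, hs hμ hwalk_symm hnot_symm, ← hsymm_one, Equiv.apply_symm_apply]

end LimitOperator

/-! ### Delayed sequences -/

/-- The stage at which the stage `α` takes place when each stage `α` is followed by `d α` extra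
stages. -/
noncomputable def dilate (d : Ordinal.{u} → ℕ) (α : Ordinal.{u}) : Ordinal.{u} :=
  limitRecOn (motive := fun _ => Ordinal.{u}) α 0 (fun α δ => δ + d α + 1) fun α _ _ => α

section dilate

variable (d : Ordinal.{u} → ℕ)

theorem dilate_zero : dilate d 0 = 0 :=
  limitRecOn_zero ..

theorem dilate_add_one (α : Ordinal.{u}) : dilate d (α + 1) = dilate d α + d α + 1 :=
  limitRecOn_add_one ..

theorem dilate_limit {α : Ordinal.{u}} (hα : IsSuccLimit α) : dilate d α = α :=
  limitRecOn_limit (h := hα) ..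

theorem dilate_add_natCast (α : Ordinal.{u}) (j : ℕ) :
    dilate d (α + j) = dilate d α + (∑ i ∈ Finset.range j, (d (α + i) + 1) : ℕ) := by
  induction j with
  | zero => simp only [Nat.cast_zero, add_zero, Finset.range_zero, Finset.sum_empty]
  | succ j ih =>
    rw [Nat.cast_add_one, ← add_assoc, dilate_add_one, ih, Finset.sum_range_succ]
    push_cast
    simp only [add_assoc]

variable {d} in
theorem dilate_lt_of_isSuccLimit {α μ : Ordinal.{u}} (hμ : IsSuccLimit μ) (hα : α < μ) :
    dilate d α < μ := by
  induction α using limitRecOn with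
  | zero => rwa [dilate_zero]
  | add_one α ih =>
    rw [dilate_add_one]
    exact hμ.add_one_lt (hμ.add_natCast_lt (ih ((lt_add_one α).trans hα)) _)
  | limit α hl _ => rwa [dilate_limit d hl]

theorem dilate_strictMono : StrictMono (dilate d) := fun α β => by
  induction β using limitRecOn with
  | zero => exact fun h => absurd h (not_lt.2 zero_le)
  | add_one β ih =>
    intro h
    have hle : dilate d α ≤ dilate d β := by
      rcases (lt_add_one_iff.1 h).eq_or_lt with rfl | hlt
      exacts [le_rfl, (ih hlt).le]
    rw [dilate_add_one]
    exact (hle.trans le_self_add).trans_lt (lt_add_one _)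
  | limit β hl _ =>
    rw [dilate_limit d hl]
    exact dilate_lt_of_isSuccLimit hl

theorem exists_dilate_add_eq (δ : Ordinal.{u}) : ∃ α, ∃ k ≤ d α, dilate d α + k = δ := by
  induction δ using limitRecOn with
  | zero => exact ⟨0, 0, Nat.zero_le _, by rw [dilate_zero, Nat.cast_zero, add_zero]⟩
  | add_one δ ih =>
    obtain ⟨α, k, hk, rfl⟩ := ih
    rcases hk.eq_or_lt with rfl | hlt
    · exact ⟨α + 1, 0, Nat.zero_le _, by rw [dilate_add_one, Nat.cast_zero, add_zero]⟩
    · exact ⟨α, k + 1, hlt, by rw [Nat.cast_add_one, add_assoc]⟩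
  | limit δ hl _ => exact ⟨δ, 0, Nat.zero_le _, by rw [dilate_limit d hl, Nat.cast_zero, add_zero]⟩

theorem exists_sum_range_add_eq (e : ℕ → ℕ) (i : ℕ) :
    ∃ j, ∃ k ≤ e j, ∑ i ∈ Finset.range j, (e i + 1) + k = i := by
  induction i with
  | zero => exact ⟨0, 0, Nat.zero_le _, rfl⟩
  | succ i ih =>
    obtain ⟨j, k, hk, rfl⟩ := ih
    rcases hk.eq_or_lt with rfl | hlt
    · exact ⟨j + 1, 0, Nat.zero_le _, Finset.sum_range_succ ..⟩
    · exact ⟨j, k + 1, hlt, rfl⟩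

variable {d} in
theorem dilate_add_lt_dilate_add_one {α : Ordinal.{u}} {k : ℕ} (hk : k ≤ d α) :
    dilate d α + k < dilate d (α + 1) := by
  rw [dilate_add_one, lt_add_one_iff]
  gcongr

end dilate

section transit

variable {n : ℕ} [NeZero n] (hn : 2 ≤ n)

/-- The symbol shown after `k` extra stages by a cell that is about to change from `x` to `x'`:
a cell that falls from `1` to `0` goes through `1, 2, …, n - 1`, any other cell waits. -/
def transit (x x' : Fin 2) (k : ℕ) : Fin n :=
  if x = 1 ∧ x' = 0 then Fin.ofNat n (k + 1) else Fin.castLE hn x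

theorem castLE_two_zero : Fin.castLE hn 0 = 0 :=
  rfl

theorem castLE_two_one : Fin.castLE hn 1 = 1 :=
  Fin.ext (Nat.mod_eq_of_lt hn).symm

theorem ofNat_add_one (k : ℕ) : Fin.ofNat n (k + 1) = Fin.ofNat n k + 1 :=
  Fin.ext (by simp [Fin.val_add])

theorem transit_of_not_fall {x x' : Fin 2} (h : ¬ (x = 1 ∧ x' = 0)) (k : ℕ) :
    transit hn x x' k = Fin.castLE hn x :=
  if_neg h

theorem transit_fall (k : ℕ) : transit hn 1 0 k = Fin.ofNat n (k + 1) :=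
  if_pos ⟨rfl, rfl⟩

theorem transit_zero (x x' : Fin 2) : transit hn x x' 0 = Fin.castLE hn x := by
  by_cases h : x = 1 ∧ x' = 0
  · obtain ⟨rfl, rfl⟩ := h
    rw [transit_fall, castLE_two_one]
    rfl
  · exact transit_of_not_fall hn h 0

theorem transit_add_one (x x' : Fin 2) (k : ℕ) :
    transit hn x x' (k + 1) = transit hn x x' k ∨
      transit hn x x' (k + 1) = transit hn x x' k + 1 := by
  by_cases h : x = 1 ∧ x' = 0
  · obtain ⟨rfl, rfl⟩ := h
    exact Or.inr (ofNat_add_one (k + 1))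
  · exact Or.inl (by rw [transit_of_not_fall hn h, transit_of_not_fall hn h])

theorem castLE_eq_transit_or {x x' : Fin 2} {k : ℕ} (hk : x = 1 → x' = 0 → k + 2 = n) :
    Fin.castLE hn x' = transit hn x x' k ∨ Fin.castLE hn x' = transit hn x x' k + 1 := by
  by_cases h : x = 1 ∧ x' = 0
  · obtain ⟨rfl, rfl⟩ := h
    refine Or.inr ?_
    rw [transit_fall, ← ofNat_add_one, hk rfl rfl, castLE_two_zero]
    exact Fin.ext (by simp)
  · rw [transit_of_not_fall hn h]
    rcases eq_or_ne x' x with rfl | hne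
    · exact Or.inl rfl
    · obtain ⟨rfl, rfl⟩ : x = 0 ∧ x' = 1 := by lia
      refine Or.inr ?_
      rw [castLE_two_zero, castLE_two_one, zero_add]

theorem transit_eq_zero_iff {x x' : Fin 2} {k : ℕ} (hk : k + 1 < n) :
    transit hn x x' k = 0 ↔ x = 0 := by
  by_cases h : x = 1 ∧ x' = 0
  · obtain ⟨rfl, rfl⟩ := h
    rw [transit_fall, Fin.ext_iff, Fin.val_ofNat, Nat.mod_eq_of_lt hk]
    simp
  · rw [transit_of_not_fall hn h, ← castLE_two_zero hn, (Fin.castLE_injective hn).eq_iff]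

end transit

/-- `g` is the sequence `f` slowed down below `μ`: each stage `α` is followed by `d α` extra
stages, exactly `n - 2` of them if `f` falls from `1` to `0`, so that the fall can be spread out by
`transit` into steps by `1`. -/
structure IsDelayed {n : ℕ} [NeZero n] (hn : 2 ≤ n) (d : Ordinal.{u} → ℕ) (f : Ordinal.{u} → Fin 2)
    (g : Ordinal.{u} → Fin n) (μ : Ordinal.{u}) : Prop where
  isSuccLimit : IsSuccLimit μ
  delay_add_two : ∀ α < μ, f α = 1 → f (α + 1) = 0 → d α + 2 = n
  apply_dilate_add : ∀ α < μ, ∀ k ≤ d α, g (dilate d α + k) = transit hn (f α) (f (α + 1)) k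

namespace IsDelayed

variable {n : ℕ} [NeZero n] {hn : 2 ≤ n} {d : Ordinal.{u} → ℕ} {f : Ordinal.{u} → Fin 2}
  {g : Ordinal.{u} → Fin n} {μ : Ordinal.{u}}

theorem mono (h : IsDelayed hn d f g μ) {ν : Ordinal.{u}} (hν : IsSuccLimit ν) (hνμ : ν ≤ μ) :
    IsDelayed hn d f g ν where
  isSuccLimit := hν
  delay_add_two α hα := h.delay_add_two α (hα.trans_le hνμ)
  apply_dilate_add α hα := h.apply_dilate_add α (hα.trans_le hνμ)

theorem apply_dilate (h : IsDelayed hn d f g μ) {α : Ordinal.{u}} (hα : α < μ) :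
    g (dilate d α) = Fin.castLE hn (f α) := by
  simpa only [Nat.cast_zero, add_zero, transit_zero]
    using h.apply_dilate_add α hα 0 (Nat.zero_le _)

theorem stabilizesAt (h : IsDelayed hn d f g μ) {x : Fin 2} (hx : StabilizesAt f μ x) :
    StabilizesAt g μ (Fin.castLE hn x) := by
  obtain ⟨κ, hκ, hconst⟩ := hx
  refine ⟨dilate d κ, dilate_lt_of_isSuccLimit h.isSuccLimit hκ, fun ξ hκξ hξ => ?_⟩
  obtain ⟨α, k, hk, rfl⟩ := exists_dilate_add_eq d ξ
  have hα : α < μ := ((dilate_strictMono d).le_apply.trans le_self_add).trans_lt hξ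
  have hκα : κ ≤ α := lt_add_one_iff.1 <|
    (dilate_strictMono d).lt_iff_lt.1 (hκξ.trans_lt (dilate_add_lt_dilate_add_one hk))
  rw [h.apply_dilate_add α hα k hk, hconst α hκα hα,
    hconst (α + 1) (hκα.trans le_self_add) (h.isSuccLimit.add_one_lt hα)]
  exact transit_of_not_fall hn (by rintro ⟨rfl, h₀⟩; exact one_ne_zero h₀) k

theorem exists_stabilizesAt (h : IsDelayed hn d f g μ) {z : Fin n} (hz : StabilizesAt g μ z) :
    ∃ x, StabilizesAt f μ x := by
  obtain ⟨κ, hκ, hconst⟩ := hz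
  have hf : ∀ α, κ ≤ α → α < μ → Fin.castLE hn (f α) = z := fun α hκα hα => by
    rw [← h.apply_dilate hα, hconst _ (hκα.trans (dilate_strictMono d).le_apply)
      (dilate_lt_of_isSuccLimit h.isSuccLimit hα)]
  exact ⟨f κ, κ, hκ, fun α hκα hα =>
    Fin.castLE_injective hn ((hf α hκα hα).trans (hf κ le_rfl hκ).symm)⟩

theorem apply_add_one (h : IsDelayed hn d f g μ) {δ : Ordinal.{u}} (hδ : δ < μ) :
    g (δ + 1) = g δ ∨ g (δ + 1) = g δ + 1 := by
  obtain ⟨α, k, hk, rfl⟩ := exists_dilate_add_eq d δ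
  have hα : α < μ := ((dilate_strictMono d).le_apply.trans le_self_add).trans_lt hδ
  rw [h.apply_dilate_add α hα k hk]
  rcases hk.eq_or_lt with rfl | hlt
  · rw [← dilate_add_one, h.apply_dilate (h.isSuccLimit.add_one_lt hα)]
    exact castLE_eq_transit_or hn (h.delay_add_two α hα)
  · rw [add_assoc, ← Nat.cast_add_one, h.apply_dilate_add α hα (k + 1) hlt]
    exact transit_add_one hn _ _ k

theorem isWalk (h : IsDelayed hn d f g μ)
    (hf : ∀ i < μ, IsSuccLimit i → ∀ x, StabilizesAt f i x → f i = x)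
    (hf_one : ∀ i < μ, IsSuccLimit i → (∀ x, ¬ StabilizesAt f i x) → f i = 1) :
    IsWalk (· + 1) 1 g μ where
  eq_or_eq_next i hi z hz := by
    rcases zero_or_succ_or_isSuccLimit i with rfl | ⟨δ, rfl⟩ | hl
    · exact absurd hz (not_stabilizesAt_zero g z)
    · rw [succ_eq_add_one] at hi hz ⊢
      rw [← stabilizesAt_add_one.1 hz]
      exact h.apply_add_one ((lt_add_one δ).trans hi)
    · obtain ⟨x, hx⟩ := (h.mono hl hi.le).exists_stabilizesAt hz
      left
      rw [← dilate_limit d hl, h.apply_dilate hi, hf i hi hl x hx]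
      exact ((h.mono hl hi.le).stabilizesAt hx).unique hz
  eq_base i hi hpos hz := by
    rcases zero_or_succ_or_isSuccLimit i with rfl | ⟨δ, rfl⟩ | hl
    · exact absurd hpos (lt_irrefl 0)
    · exact absurd (stabilizesAt_add_one.2 rfl) (hz (g δ))
    · have hx : ∀ x, ¬ StabilizesAt f i x := fun x hx =>
        hz _ ((h.mono hl hi.le).stabilizesAt hx)
      rw [← dilate_limit d hl, h.apply_dilate hi, hf_one i hi hl hx, castLE_two_one]

end IsDelayed

open OrdWord (restrict)

/-! ### Machines and their simulators -/

section sup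

variable {F : Ordinal.{u} → ℕ → Fin 2} {μ : Ordinal.{u}} {c : ℕ}

theorem sup_restrict_of_stabilizesAt {x : Fin 2} (h : StabilizesAt (F · c) μ x) :
    LimitOperator.sup (restrict F μ) c = x := by
  obtain rfl | rfl : x = 0 ∨ x = 1 := by lia
  · exact if_pos <| h.imp fun κ hκ => ⟨hκ.1, fun ξ hξ hκξ => hκ.2 ξ hκξ hξ⟩
  · refine if_neg fun ⟨κ, hκ, hκ₀⟩ => zero_ne_one (α := Fin 2) ?_
    exact StabilizesAt.unique ⟨κ, hκ, fun ξ hκξ hξ => hκ₀ ξ hξ hκξ⟩ h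

theorem sup_restrict_of_not_stabilizesAt (h : ∀ x, ¬ StabilizesAt (F · c) μ x) :
    LimitOperator.sup (restrict F μ) c = 1 :=
  if_neg fun ⟨κ, hκ, hκ₀⟩ => h 0 ⟨κ, hκ, fun ξ hκξ hξ => hκ₀ ξ hξ hκξ⟩

end sup

theorem cell_div (t : Fin 3) (i : ℕ) : cell t i / 3 = i := by
  unfold cell
  lia

theorem ofNat_cell (t : Fin 3) (i : ℕ) : Fin.ofNat 3 (cell t i) = t :=
  Fin.ext (by simp only [Fin.val_ofNat, cell]; lia)

theorem cell_ofNat (c : ℕ) : cell (Fin.ofNat 3 c) (c / 3) = c := by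
  simp only [cell, Fin.val_ofNat]
  lia

namespace Machine

section run

variable {n : ℕ} (M : Machine n)

theorem step_of_halted {s : Snapshot n M.State} (h : s.state = M.halt) : M.step s = s :=
  if_pos h

variable {M} in
theorem step_of_trans_eq {s : Snapshot n M.State} {out : M.State × (Fin 3 → Fin n) × Move}
    (hs : s.state ≠ M.halt) (hout : M.trans s.state (fun t => s.tape (cell t s.head)) = out) :
    M.step s =
      { state := out.1
        head := out.2.2.apply s.head
        tape := fun c => if c / 3 = s.head then out.2.1 (Fin.ofNat 3 c) else s.tape c } := by
  rw [← hout]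
  exact if_neg hs

variable [NeZero n] (Γ : LimitOperator.{u} n) (y : ℕ → Fin n)

theorem run_zero : M.run Γ y 0 = M.init y :=
  limitRecOn_zero ..

theorem run_add_one (α : Ordinal.{u}) : M.run Γ y (α + 1) = M.step (M.run Γ y α) :=
  limitRecOn_add_one ..

open Classical in
theorem run_limit {μ : Ordinal.{u}} (hμ : IsSuccLimit μ) :
    M.run Γ y μ = if h : ∃ (β : Ordinal.{u}) (_ : β < μ), (M.run Γ y β).state = M.halt then
      M.run Γ y h.choose else ⟨M.limit, 0, Γ (restrict (fun β => (M.run Γ y β).tape) μ)⟩ :=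
  limitRecOn_limit (h := hμ) ..

theorem run_limit_of_not_halted {μ : Ordinal.{u}} (hμ : IsSuccLimit μ)
    (h : ∀ β < μ, (M.run Γ y β).state ≠ M.halt) :
    M.run Γ y μ = ⟨M.limit, 0, Γ (restrict (fun β => (M.run Γ y β).tape) μ)⟩ := by
  rw [run_limit M Γ y hμ, dif_neg]
  exact fun ⟨β, hβ, hhalt⟩ => h β hβ hhalt

theorem run_of_halted {α β : Ordinal.{u}} (h : (M.run Γ y β).state = M.halt) (hβα : β ≤ α) :
    M.run Γ y α = M.run Γ y β := by
  induction α using WellFoundedLT.induction generalizing β with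
  | ind α ih =>
    rcases hβα.eq_or_lt with rfl | hlt
    · rfl
    rcases zero_or_succ_or_isSuccLimit α with rfl | ⟨α, rfl⟩ | hl
    · exact absurd hlt (not_lt.2 zero_le)
    · have hα := ih α (lt_succ α) h (lt_succ_iff.1 hlt)
      rw [succ_eq_add_one, run_add_one, hα, step_of_halted M h]
    · have hex : ∃ (β : Ordinal.{u}) (_ : β < α), (M.run Γ y β).state = M.halt := ⟨β, hlt, h⟩
      rw [run_limit M Γ y hl, dif_pos hex]
      obtain ⟨hγα, hγ⟩ := hex.choose_spec
      rcases le_total β hex.choose with hle | hle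
      · exact ih _ hγα h hle
      · exact (ih β hlt hγ hle).symm

end run

section sup

variable (M : Machine 2) (y : ℕ → Fin 2) {μ : Ordinal.{u}} (hμ : IsSuccLimit μ)
  (h : ∀ β < μ, (M.run LimitOperator.sup y β).state ≠ M.halt) {c : ℕ}

include hμ h

theorem run_sup_of_stabilizesAt {x : Fin 2}
    (hx : StabilizesAt (fun β => (M.run LimitOperator.sup y β).tape c) μ x) :
    (M.run LimitOperator.sup y μ).tape c = x := by
  rw [run_limit_of_not_halted M _ y hμ h]
  exact sup_restrict_of_stabilizesAt hx

theorem run_sup_of_not_stabilizesAt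
    (hx : ∀ x, ¬ StabilizesAt (fun β => (M.run LimitOperator.sup y β).tape c) μ x) :
    (M.run LimitOperator.sup y μ).tape c = 1 := by
  rw [run_limit_of_not_halted M _ y hμ h]
  exact sup_restrict_of_not_stabilizesAt hx

end sup

variable {n : ℕ} [NeZero n] (hn : 2 ≤ n) (M : Machine 2)

/-- The `n`-symbol machine that carries out the steps of `M`, taking all the nonzero symbols for
`1`, except that it first increases step by step from `1` to `n - 1` the symbols of the cells that
`M` changes from `1` to `0`. -/
def simulator : Machine n where
  State := M.State
  finite := M.finite
  start := M.start
  limit := M.limit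
  halt := M.halt
  trans q r :=
    let out := M.trans q fun t => if r t = 0 then 0 else 1
    if ∃ t, out.2.1 t = 0 ∧ r t ≠ 0 ∧ r t + 1 ≠ 0 then
      (q, fun t => if out.2.1 t = 0 ∧ r t ≠ 0 then r t + 1 else r t, .stay)
    else (out.1, fun t => Fin.castLE hn (out.2.1 t), out.2.2)

/-- The step of `M` from the snapshot `s` changes the symbol of the cell `c` from `1` to `0`. -/
def Falls (s : Snapshot 2 M.State) (c : ℕ) : Prop :=
  s.tape c = 1 ∧ (M.step s).tape c = 0

/-- The snapshot of `M.simulator` after `k` extra steps from the snapshot `s` of `M`. -/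
noncomputable def phase (s : Snapshot 2 M.State) (k : ℕ) : Snapshot n M.State where
  state := s.state
  head := s.head
  tape c := transit hn (s.tape c) ((M.step s).tape c) k

open Classical in
variable (n) in
/-- The number of extra steps of `M.simulator` between the snapshot `s` of `M` and the next one. -/
noncomputable def delay (s : Snapshot 2 M.State) : ℕ :=
  if ∃ c, M.Falls s c then n - 2 else 0

section step

variable {hn M} {s : Snapshot 2 M.State} {c k : ℕ}

theorem step_tape_of_div_eq (hs : s.state ≠ M.halt) (hc : c / 3 = s.head) :
    (M.step s).tape c =
      (M.trans s.state fun t => s.tape (cell t s.head)).2.1 (Fin.ofNat 3 c) := by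
  rw [step_of_trans_eq hs rfl]
  exact if_pos hc

theorem step_tape_of_div_ne (hs : s.state ≠ M.halt) (hc : c / 3 ≠ s.head) :
    (M.step s).tape c = s.tape c := by
  rw [step_of_trans_eq hs rfl]
  exact if_neg hc

theorem Falls.state_ne_halt (h : M.Falls s c) : s.state ≠ M.halt := fun hs => by
  have h₀ := h.2
  rw [step_of_halted M hs, h.1] at h₀
  exact one_ne_zero h₀

theorem Falls.div_eq (h : M.Falls s c) : c / 3 = s.head := by
  by_contra hc
  have h₀ := h.2
  rw [step_tape_of_div_ne h.state_ne_halt hc, h.1] at h₀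
  exact one_ne_zero h₀

theorem exists_falls_iff (hs : s.state ≠ M.halt) :
    (∃ c, M.Falls s c) ↔ ∃ t, s.tape (cell t s.head) = 1 ∧
      (M.trans s.state fun t => s.tape (cell t s.head)).2.1 t = 0 := by
  constructor
  · rintro ⟨c, hc⟩
    refine ⟨Fin.ofNat 3 c, ?_, ?_⟩
    · rw [← hc.div_eq, cell_ofNat, hc.1]
    · rw [← step_tape_of_div_eq hs hc.div_eq, hc.2]
  · rintro ⟨t, ht, ht₀⟩
    refine ⟨cell t s.head, ht, ?_⟩
    rw [step_tape_of_div_eq hs (cell_div t s.head), ofNat_cell, ht₀]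

open Classical in
theorem simulator_trans_transit (hk : k + 1 < n) (q : M.State) (r : Fin 3 → Fin 2) :
    (M.simulator hn).trans q (fun t => transit hn (r t) ((M.trans q r).2.1 t) k) =
      if (∃ t, r t = 1 ∧ (M.trans q r).2.1 t = 0) ∧ k + 2 < n then
        (q, fun t => transit hn (r t) ((M.trans q r).2.1 t) (k + 1), .stay)
      else
        ((M.trans q r).1, fun t => Fin.castLE hn ((M.trans q r).2.1 t), (M.trans q r).2.2) := by
  have hread : (fun t => if transit hn (r t) ((M.trans q r).2.1 t) k = 0 then 0 else 1) = r := by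
    funext t
    simp only [transit_eq_zero_iff hn hk]
    split_ifs <;> lia
  have hfall (t : Fin 3) : (M.trans q r).2.1 t = 0 ∧
      transit hn (r t) ((M.trans q r).2.1 t) k ≠ 0 ↔ r t = 1 ∧ (M.trans q r).2.1 t = 0 := by
    rw [Ne, transit_eq_zero_iff hn hk]
    lia
  have hcond : (∃ t, (M.trans q r).2.1 t = 0 ∧ transit hn (r t) ((M.trans q r).2.1 t) k ≠ 0 ∧
      transit hn (r t) ((M.trans q r).2.1 t) k + 1 ≠ 0) ↔
      (∃ t, r t = 1 ∧ (M.trans q r).2.1 t = 0) ∧ k + 2 < n := by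
    simp only [← and_assoc, hfall, ← exists_and_right]
    refine exists_congr fun t => and_congr_right fun ⟨h₁, h₀⟩ => ?_
    rw [h₁, h₀, transit_fall, ← ofNat_add_one, Ne, Fin.ext_iff, Fin.val_ofNat, Fin.val_zero]
    rcases (Nat.succ_le_of_lt hk).eq_or_lt with heq | hlt
    · simp [← heq]
    · simp [Nat.mod_eq_of_lt hlt, hlt]
  simp only [simulator, hread, hcond]
  refine if_congr Iff.rfl ?_ rfl
  congr
  funext t
  simp only [hfall]
  split_ifs with h
  · rw [h.1, h.2, transit_fall, transit_fall, ofNat_add_one (k + 1)]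
  · rw [transit_of_not_fall hn h, transit_of_not_fall hn h]

theorem phase_read (hs : s.state ≠ M.halt) (k : ℕ) :
    (fun t => (M.phase hn s k).tape (cell t s.head)) =
      fun t => transit hn (s.tape (cell t s.head))
        ((M.trans s.state fun t => s.tape (cell t s.head)).2.1 t) k := by
  funext t
  simp only [phase, step_tape_of_div_eq hs (cell_div _ _), ofNat_cell]

theorem simulator_step_phase_of_falls (h : ∃ c, M.Falls s c) (hk : k + 2 < n) :
    (M.simulator hn).step (M.phase hn s k) = M.phase hn s (k + 1) := by
  have hs : s.state ≠ M.halt := h.elim fun _ => Falls.state_ne_halt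
  have htrans := simulator_trans_transit (hn := hn) (M := M) ((Nat.lt_succ_self _).trans hk)
    s.state fun t => s.tape (cell t s.head)
  rw [← phase_read hs, if_pos ⟨(exists_falls_iff hs).1 h, hk⟩] at htrans
  rw [step_of_trans_eq (M := M.simulator hn) (s := M.phase hn s k) hs htrans]
  refine Snapshot.ext rfl rfl (funext fun c => ?_)
  change ite (c / 3 = s.head) (transit hn (s.tape (cell (Fin.ofNat 3 c) s.head)) _ (k + 1))
    (transit hn _ _ k) = transit hn _ _ (k + 1)
  split_ifs with hc
  · rw [step_tape_of_div_eq hs hc, ← hc, cell_ofNat]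
  · have hfall : ¬ (s.tape c = 1 ∧ (M.step s).tape c = 0) := fun h => hc (Falls.div_eq h)
    rw [transit_of_not_fall hn hfall, transit_of_not_fall hn hfall]

theorem simulator_step_phase (h : (∃ c, M.Falls s c) → k + 2 = n) (hk : k + 1 < n) :
    (M.simulator hn).step (M.phase hn s k) = M.phase hn (M.step s) 0 := by
  by_cases hs : s.state = M.halt
  · rw [step_of_halted (M.simulator hn) (s := M.phase hn s k) hs, step_of_halted M hs]
    refine Snapshot.ext rfl rfl (funext fun c => ?_)
    have hfall : ¬ (s.tape c = 1 ∧ (M.step s).tape c = 0) := fun h => Falls.state_ne_halt h hs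
    exact (transit_of_not_fall hn hfall k).trans (transit_of_not_fall hn hfall 0).symm
  have htrans := simulator_trans_transit (hn := hn) (M := M) hk
    s.state fun t => s.tape (cell t s.head)
  rw [← phase_read hs, if_neg fun hr => hr.2.ne (h ((exists_falls_iff hs).2 hr.1))] at htrans
  rw [step_of_trans_eq (M := M.simulator hn) (s := M.phase hn s k) hs htrans]
  have hstep := step_of_trans_eq hs rfl
  refine Snapshot.ext (congrArg (·.state) hstep.symm) (congrArg (·.head) hstep.symm)
    (funext fun c => ?_)
  change ite (c / 3 = s.head) _ (transit hn _ _ k) = transit hn _ _ 0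
  rw [transit_zero]
  split_ifs with hc
  · rw [step_tape_of_div_eq hs hc]
  · have hfall : ¬ (s.tape c = 1 ∧ (M.step s).tape c = 0) := fun h => hc (Falls.div_eq h)
    rw [transit_of_not_fall hn hfall, step_tape_of_div_ne hs hc]

end step

end Machine

namespace Machine

variable {n : ℕ} {M : Machine 2}

section delay

variable {s : Snapshot 2 M.State} {k : ℕ}

theorem Falls.delay_add_two {c : ℕ} (hn : 2 ≤ n) (h : M.Falls s c) : M.delay n s + 2 = n := by
  rw [delay, if_pos ⟨c, h⟩, Nat.sub_add_cancel hn]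

theorem exists_falls_of_lt_delay (h : k < M.delay n s) : ∃ c, M.Falls s c := by
  by_contra hfalls
  rw [delay, if_neg hfalls] at h
  exact absurd h (Nat.not_lt_zero k)

theorem delay_add_one_lt (hn : 2 ≤ n) (s : Snapshot 2 M.State) : M.delay n s + 1 < n := by
  unfold delay
  split_ifs <;> lia

theorem exists_two_le_phase_tape [NeZero n] {hn : 2 ≤ n} (hk₀ : 0 < k) (hk : k ≤ M.delay n s) :
    ∃ c, 2 ≤ ((M.phase hn s k).tape c : ℕ) := by
  obtain ⟨c, hc⟩ := exists_falls_of_lt_delay (hk₀.trans_le hk)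
  have hkn : k + 1 < n := (Nat.add_le_add_right hk 1).trans_lt (delay_add_one_lt hn s)
  refine ⟨c, ?_⟩
  simp only [phase, hc.1, hc.2, transit_fall, Fin.val_ofNat, Nat.mod_eq_of_lt hkn]
  lia

end delay

section run

variable [NeZero n] {hn : 2 ≤ n} {Γ : LimitOperator.{u} n} {y : ℕ → Fin n} {δ : Ordinal.{u}}
  {s : Snapshot 2 M.State}

theorem simulator_run_add_natCast (h : (M.simulator hn).run Γ y δ = M.phase hn s 0) {k : ℕ}
    (hk : k ≤ M.delay n s) : (M.simulator hn).run Γ y (δ + k) = M.phase hn s k := by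
  induction k with
  | zero => rwa [Nat.cast_zero, add_zero]
  | succ k ih =>
    rw [Nat.cast_add_one, ← add_assoc, run_add_one, ih (Nat.le_of_succ_le hk)]
    obtain ⟨c, hc⟩ := exists_falls_of_lt_delay hk
    exact simulator_step_phase_of_falls ⟨c, hc⟩ (by have := hc.delay_add_two hn; lia)

theorem simulator_run_add_delay_add_one (h : (M.simulator hn).run Γ y δ = M.phase hn s 0) :
    (M.simulator hn).run Γ y (δ + M.delay n s + 1) = M.phase hn (M.step s) 0 := by
  rw [run_add_one, simulator_run_add_natCast h le_rfl]
  exact simulator_step_phase (fun ⟨_, hc⟩ => hc.delay_add_two hn) (delay_add_one_lt hn s)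

end run

section simulation

variable [NeZero n] {hn : 2 ≤ n} {Γ : LimitOperator.{u} n} (n) (M) (y : ℕ → Fin 2)

/-- The number of extra steps of `M.simulator` after the stage `α` of `M` on the input `y`. -/
noncomputable def delayAt (α : Ordinal.{u}) : ℕ :=
  M.delay n (M.run LimitOperator.sup y α)

variable {n M y} {μ : Ordinal.{u}}

theorem simulator_run_limit_of_halted {β : Ordinal.{u}} (hβμ : β < μ) (hμ : IsSuccLimit μ)
    (hrun : (M.simulator hn).run Γ (fun i => Fin.castLE hn (y i)) (dilate (delayAt n M y) β) =
      M.phase hn (M.run LimitOperator.sup y β) 0)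
    (hβ : (M.run LimitOperator.sup y β).state = M.halt) :
    (M.simulator hn).run Γ (fun i => Fin.castLE hn (y i)) μ =
      M.phase hn (M.run LimitOperator.sup y μ) 0 := by
  rw [run_of_halted M _ y hβ hβμ.le, ← hrun]
  exact run_of_halted _ _ _ (by rw [hrun]; exact hβ) (dilate_lt_of_isSuccLimit hμ hβμ).le

variable (h : ∀ α < μ, (M.simulator hn).run Γ (fun i => Fin.castLE hn (y i))
  (dilate (delayAt n M y) α) = M.phase hn (M.run LimitOperator.sup y α) 0)

include h

theorem isDelayed_simulator_run (hμ : IsSuccLimit μ) (c : ℕ) :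
    IsDelayed hn (delayAt n M y) (fun α => (M.run LimitOperator.sup y α).tape c)
      (fun δ => ((M.simulator hn).run Γ (fun i => Fin.castLE hn (y i)) δ).tape c) μ where
  isSuccLimit := hμ
  delay_add_two α _ h₁ h₀ := Falls.delay_add_two hn ⟨h₁, by rwa [← run_add_one]⟩
  apply_dilate_add α hα k hk := by rw [simulator_run_add_natCast (h α hα) hk, run_add_one]; rfl

theorem simulator_run_state_ne_halt
    (hM : ∀ β < μ, (M.run LimitOperator.sup y β).state ≠ M.halt) {δ : Ordinal.{u}} (hδ : δ < μ) :
    ((M.simulator hn).run Γ (fun i => Fin.castLE hn (y i)) δ).state ≠ (M.simulator hn).halt := by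
  obtain ⟨α, k, hk, rfl⟩ := exists_dilate_add_eq (delayAt n M y) δ
  have hα : α < μ := ((dilate_strictMono _).le_apply.trans le_self_add).trans_lt hδ
  rw [simulator_run_add_natCast (h α hα) hk]
  exact hM α hα

end simulation

end Machine

namespace LimitOperator

open Machine

variable {n : ℕ} [NeZero n] {hn : 2 ≤ n} {Γ : LimitOperator.{u} n}

theorem IsSupOnWalks.simulator_run_tape_limit (hΓ : Γ.IsSupOnWalks) {M : Machine 2} {y : ℕ → Fin 2}
    {μ : Ordinal.{u}} (hμ : IsSuccLimit μ) (hM : ∀ β < μ, (M.run sup y β).state ≠ M.halt)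
    (h : ∀ α < μ, (M.simulator hn).run Γ (fun i => Fin.castLE hn (y i))
      (dilate (delayAt n M y) α) = M.phase hn (M.run sup y α) 0) (c : ℕ) :
    ((M.simulator hn).run Γ (fun i => Fin.castLE hn (y i)) μ).tape c =
      Fin.castLE hn ((M.run sup y μ).tape c) := by
  have hdelayed := isDelayed_simulator_run h hμ c
  rw [run_limit_of_not_halted _ _ _ hμ fun _ => simulator_run_state_ne_halt h hM]
  by_cases hx : ∃ x, StabilizesAt (fun β => (M.run sup y β).tape c) μ x
  · obtain ⟨x, hx⟩ := hx
    rw [run_sup_of_stabilizesAt M y hμ hM hx]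
    exact hΓ.of_stabilizesAt hμ (hdelayed.stabilizesAt hx)
  · rw [run_sup_of_not_stabilizesAt M y hμ hM (not_exists.1 hx), castLE_two_one]
    refine hΓ.of_isWalk hμ (hdelayed.isWalk (fun i hi hl x => ?_) fun i hi hl => ?_)
      fun _ hz => hx (hdelayed.exists_stabilizesAt hz)
    · exact run_sup_of_stabilizesAt M y hl fun β hβ => hM β (hβ.trans hi)
    · exact run_sup_of_not_stabilizesAt M y hl fun β hβ => hM β (hβ.trans hi)

theorem IsSupOnWalks.simulator_run_dilate (hΓ : Γ.IsSupOnWalks) (M : Machine 2) (y : ℕ → Fin 2)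
    (α : Ordinal.{u}) :
    (M.simulator hn).run Γ (fun i => Fin.castLE hn (y i)) (dilate (delayAt n M y) α) =
      M.phase hn (M.run sup y α) 0 := by
  induction α using limitRecOn with
  | zero =>
    rw [dilate_zero, run_zero, run_zero]
    refine Snapshot.ext rfl rfl (funext fun c => ?_)
    refine Eq.trans ?_ (transit_zero hn _ _).symm
    simp only [init, apply_ite (Fin.castLE hn), castLE_two_zero]
  | add_one α ih =>
    rw [dilate_add_one, run_add_one M]
    exact simulator_run_add_delay_add_one ih
  | limit μ hμ ih =>
    rw [dilate_limit _ hμ]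
    by_cases hM : ∃ β < μ, (M.run sup y β).state = M.halt
    · obtain ⟨β, hβμ, hβ⟩ := hM
      exact simulator_run_limit_of_halted hβμ hμ (ih β hβμ) hβ
    push Not at hM
    have hN := fun δ => simulator_run_state_ne_halt ih hM (δ := δ)
    refine Snapshot.ext ?state ?head (funext fun c => ?tape)
    case state | head =>
      rw [run_limit_of_not_halted _ _ _ hμ hN, run_limit_of_not_halted M _ _ hμ hM]
      rfl
    case tape =>
      exact (hΓ.simulator_run_tape_limit hμ hM ih c).trans (transit_zero hn _ _).symm

theorem IsSupOnWalks.emulates (hΓ : Γ.IsSupOnWalks) : Emulates hn Γ sup := by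
  intro M
  have hmatch (y) (α : Ordinal.{u}) : (M.run sup y α).Matches hn id
      ((M.simulator hn).run Γ (fun i => Fin.castLE hn (y i)) (dilate (delayAt n M y) α)) := by
    rw [hΓ.simulator_run_dilate]
    exact ⟨rfl, rfl, fun c => transit_zero hn _ _⟩
  refine ⟨M.simulator hn, id, Function.injective_id, rfl, rfl, rfl, fun y => ⟨fun μ hμ => ?_, ?_⟩⟩
  · have hlimit := hmatch y μ
    rwa [dilate_limit _ hμ] at hlimit
  intro μ hμ
  have hdilate : dilate (delayAt n M y) μ = μ := by
    rcases hμ with rfl | hμ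
    exacts [dilate_zero _, dilate_limit _ hμ]
  have hφ (j : ℕ) := hdilate ▸ dilate_add_natCast (delayAt n M y) μ j
  refine ⟨fun j => ∑ i ∈ Finset.range j, (delayAt n M y (μ + i) + 1),
    strictMono_nat_of_lt_succ fun j => ?_, Finset.sum_range_zero _, fun j => ?_, fun i hi => ?_⟩
  · simp only [Finset.sum_range_succ]
    lia
  · rw [← hφ]
    exact hmatch y _
  · obtain ⟨j, k, hk, rfl⟩ := exists_sum_range_add_eq (fun j => delayAt n M y (μ + j)) i
    rw [Nat.cast_add, ← add_assoc, ← hφ,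
      simulator_run_add_natCast (hΓ.simulator_run_dilate M y _) hk]
    refine exists_two_le_phase_tape (Nat.pos_of_ne_zero fun hk₀ => hi ⟨j, ?_⟩) hk
    rw [hk₀, add_zero]

end LimitOperator

end InfTM

theorem mainTheorem8 (n : ℕ) [NeZero n] (hn : 2 ≤ n) (Γ : InfTM.LimitOperator.{u} n)
    (hΓ : Γ.Simulational) (hloop : Γ.LoopingStable) :
    ∃ σ : Equiv.Perm (Fin n),
      InfTM.Emulates hn (Γ.rename σ) InfTM.LimitOperator.sup.{u} := by
  obtain ⟨σ, hσ⟩ := hΓ.exists_rename_isSupOnWalks hloop hn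
  exact ⟨σ, hσ.emulates⟩
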